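/- Let $\alpha>-1$, $M,N\ge 0$ and $c>0$. On the space of real polynomials consider the Laguerre inner product $$\langle f,g\rangle_\alpha=\int_0^\infty f(x)g(x)\,x^\alpha e^{-x}\,dx$$ and the discrete Sobolev inner product $$\langle f,g\rangle_S=\langle f,g\rangle_\alpha+M f(c)g(c)+N f'(c)g'(c),$$ and write $\|f\|_\alpha^2=\langle f,f\rangle_\alpha$, $\|f\|_S^2=\langle f,f\rangle_S$. Let $(\widehat L_n^\alpha)_{n\ge0}$ and $(\widehat S_n^{M,N})_{n\ge0}$ be the sequences of monic orthogonal polynomials ($\deg\widehat L_n^\alpha=\deg\widehat S_n^{M,N}=n$) with respect to $\langle\cdot,\cdot\rangle_\alpha$ and $\langle\cdot,\cdot\rangle_S$, respectively, and for $n\ge1$ put $$B_1(n;c)=\frac{M\,\widehat S_n^{M,N}(c)\,\widehat L_n^\alpha(c)}{\|\widehat L_{n-1}^\alpha\|_\alpha^2}+\frac{N\,[\widehat S_n^{M,N}]'(c)\,[\widehat L_n^\alpha]'(c)}{\|\widehat L_{n-1}^\alpha\|_\alpha^2}.$$ Then, for every $n\ge1$, $$\|\widehat S_n^{M,N}\|_S^2=\|\widehat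 L_n^\alpha\|_\alpha^2+B_1(n;c)\,\|\widehat L_{n-1}^\alpha\|_\alpha^2 .$$ Moreover $\|\widehat S_n^{M,N}\|_S^2\sim\Gamma(n+1)\Gamma(n+\alpha+1)$, where $u_n\sim v_n$ means that the sequence $u_n/v_n$ converges to some nonzero constant as $n\to\infty$. -/

import Mathlib

open Polynomial Filter Topology MeasureTheory

noncomputable section

/-- The Laguerre inner product `⟨f, g⟩_α = ∫₀^∞ f(x) g(x) x^α e^{-x} dx` on real polynomials. -/
def laguerreInner (α : ℝ) (f g : ℝ[X]) : ℝ :=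
  ∫ x in Set.Ioi (0 : ℝ), f.eval x * g.eval x * x ^ α * Real.exp (-x)

/-- The discrete Laguerre-Sobolev inner product
`⟨f, g⟩_S = ⟨f, g⟩_α + M f(c) g(c) + N f'(c) g'(c)` on real polynomials. -/
def sobolevInner (α M N c : ℝ) (f g : ℝ[X]) : ℝ :=
  laguerreInner α f g + M * f.eval c * g.eval c
    + N * (derivative f).eval c * (derivative g).eval c

/-- The sequence of monic orthogonal polynomials of an inner product `B` on real polynomials,
obtained from the monomials `1, X, X ^ 2, …` by Gram-Schmidt orthogonalization without
normalization. -/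
def monicOrthogonal (B : ℝ[X] → ℝ[X] → ℝ) : ℕ → ℝ[X]
  | n => X ^ n - ∑ k : Fin n,
      C (B (X ^ n) (monicOrthogonal B k) / B (monicOrthogonal B k) (monicOrthogonal B k))
        * monicOrthogonal B k
  decreasing_by all_goals exact k.isLt

/-- The monic Laguerre polynomial of degree `n`. -/
def monicLaguerre (α : ℝ) (n : ℕ) : ℝ[X] :=
  monicOrthogonal (laguerreInner α) n

/-- The monic Laguerre-Sobolev type polynomial of degree `n`. -/
def laguerreSobolev (α M N c : ℝ) (n : ℕ) : ℝ[X] :=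
  monicOrthogonal (sobolevInner α M N c) n

/-- The squared norm `‖f‖_α² = ⟨f, f⟩_α`. -/
def laguerreNormSq (α : ℝ) (f : ℝ[X]) : ℝ := laguerreInner α f f

/-- The squared Sobolev norm `‖f‖_S² = ⟨f, f⟩_S`. -/
def sobolevNormSq (α M N c : ℝ) (f : ℝ[X]) : ℝ := sobolevInner α M N c f f

/-- The connection coefficient `B₁(n; c)`, for `n ≥ 1`. -/
def coeffB1 (α M N c : ℝ) (n : ℕ) : ℝ :=
  M * (laguerreSobolev α M N c n).eval c * (monicLaguerre α n).eval c
      / laguerreNormSq α (monicLaguerre α (n - 1))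
    + N * (derivative (laguerreSobolev α M N c n)).eval c
        * (derivative (monicLaguerre α n)).eval c
      / laguerreNormSq α (monicLaguerre α (n - 1))

/-- `u_n ∼ v_n`: the ratio `u_n / v_n` converges to some nonzero constant as `n → ∞`. -/
def AsympSim (u v : ℕ → ℝ) : Prop :=
  ∃ κ : ℝ, κ ≠ 0 ∧ Tendsto (fun n => u n / v n) atTop (𝓝 κ)

end

theorem monicOrthogonal_eq (B : ℝ[X] → ℝ[X] → ℝ) (n : ℕ) :
    monicOrthogonal B n = X ^ n - ∑ k : Fin n,
      C (B (X ^ n) (monicOrthogonal B k) / B (monicOrthogonal B k) (monicOrthogonal B k))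
        * monicOrthogonal B k := by
  rw [monicOrthogonal]

theorem degree_monicOrthogonal_sub_lt (B : ℝ[X] → ℝ[X] → ℝ) (n : ℕ) :
    (monicOrthogonal B n - X ^ n).degree < (n : WithBot ℕ) := by
  induction n using Nat.strong_induction_on with
  | _ n ih =>
    rw [monicOrthogonal_eq, sub_sub_cancel_left, degree_neg, ← mem_degreeLT]
    refine Submodule.sum_mem _ fun k _ => ?_
    rw [C_mul']
    refine Submodule.smul_mem _ _ ?_
    have h1 : monicOrthogonal B k = (monicOrthogonal B k - X ^ (k : ℕ)) + X ^ (k : ℕ) := by ring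
    rw [h1]
    refine Submodule.add_mem _ ?_ ?_ <;> rw [mem_degreeLT]
    · exact (ih k k.2).trans (by exact_mod_cast k.2)
    · rw [degree_X_pow]; exact_mod_cast k.2

theorem monic_monicOrthogonal (B : ℝ[X] → ℝ[X] → ℝ) (n : ℕ) :
    (monicOrthogonal B n).Monic := by
  have := monic_X_pow_add (degree_monicOrthogonal_sub_lt B n)
  rwa [add_sub_cancel] at this

theorem degree_monicOrthogonal (B : ℝ[X] → ℝ[X] → ℝ) (n : ℕ) :
    (monicOrthogonal B n).degree = (n : WithBot ℕ) := by
  have h1 : monicOrthogonal B n = (monicOrthogonal B n - X ^ n) + X ^ n := by ring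
  rw [h1, degree_add_eq_right_of_degree_lt, degree_X_pow]
  rw [degree_X_pow]
  exact degree_monicOrthogonal_sub_lt B n

/-- A symmetric positive definite bilinear form on real polynomials. -/
structure IsInnerProduct (B : ℝ[X] → ℝ[X] → ℝ) : Prop where
  symm : ∀ f g, B f g = B g f
  add_left : ∀ f g h, B (f + g) h = B f h + B g h
  smul_left : ∀ a f h, B (C a * f) h = a * B f h
  pos : ∀ f, f ≠ 0 → 0 < B f f

namespace IsInnerProduct

variable {B : ℝ[X] → ℝ[X] → ℝ} (hB : IsInnerProduct B)
include hB

theorem add_right (f g h : ℝ[X]) : B h (f + g) = B h f + B h g := by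
  rw [hB.symm h, hB.add_left, hB.symm f, hB.symm g]

theorem smul_right (a : ℝ) (f h : ℝ[X]) : B h (C a * f) = a * B h f := by
  rw [hB.symm h, hB.smul_left, hB.symm f]

theorem zero_left (h : ℝ[X]) : B 0 h = 0 := by
  simpa using hB.smul_left 0 0 h

theorem zero_right (h : ℝ[X]) : B h 0 = 0 := by
  rw [hB.symm, hB.zero_left]

theorem sub_left (f g h : ℝ[X]) : B (f - g) h = B f h - B g h := by
  have := hB.add_left (f - g) g h
  rw [sub_add_cancel] at this
  linarith

theorem sub_right (f g h : ℝ[X]) : B h (f - g) = B h f - B h g := by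
  rw [hB.symm h, hB.sub_left, hB.symm f, hB.symm g]

theorem sum_left {ι : Type*} (s : Finset ι) (f : ι → ℝ[X]) (h : ℝ[X]) :
    B (∑ i ∈ s, f i) h = ∑ i ∈ s, B (f i) h := by
  classical
  induction s using Finset.induction_on with
  | empty => simp [hB.zero_left]
  | insert a s ha ih => rw [Finset.sum_insert ha, Finset.sum_insert ha, hB.add_left, ih]

theorem sum_right {ι : Type*} (s : Finset ι) (f : ι → ℝ[X]) (h : ℝ[X]) :
    B h (∑ i ∈ s, f i) = ∑ i ∈ s, B h (f i) := by
  rw [hB.symm, hB.sum_left]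
  exact Finset.sum_congr rfl fun i _ => hB.symm _ _

theorem nonneg (f : ℝ[X]) : 0 ≤ B f f := by
  rcases eq_or_ne f 0 with rfl | h
  · rw [hB.zero_left]
  · exact (hB.pos f h).le

theorem monicOrthogonal_self_pos (n : ℕ) :
    0 < B (monicOrthogonal B n) (monicOrthogonal B n) :=
  hB.pos _ (monic_monicOrthogonal B n).ne_zero

theorem monicOrthogonal_orthogonal_of_lt (n : ℕ) :
    ∀ k < n, B (monicOrthogonal B n) (monicOrthogonal B k) = 0 := by
  induction n using Nat.strong_induction_on with
  | _ n ih =>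
    intro k hk
    have hne := (hB.monicOrthogonal_self_pos k).ne'
    rw [monicOrthogonal_eq B n, hB.sub_left, hB.sum_left,
      Finset.sum_eq_single (⟨k, hk⟩ : Fin n)]
    · rw [hB.smul_left]
      field_simp
      simp
    · intro j _ hj
      rw [hB.smul_left]
      rcases lt_trichotomy (j : ℕ) k with h | h | h
      · rw [hB.symm (monicOrthogonal B j) (monicOrthogonal B k), ih k hk j h, mul_zero]
      · exact absurd (Fin.ext h) hj
      · rw [ih j j.2 k h, mul_zero]
    · simp

theorem monicOrthogonal_orthogonal {m n : ℕ} (h : m ≠ n) :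
    B (monicOrthogonal B m) (monicOrthogonal B n) = 0 := by
  rcases h.lt_or_gt with h | h
  · rw [hB.symm]; exact hB.monicOrthogonal_orthogonal_of_lt _ _ h
  · exact hB.monicOrthogonal_orthogonal_of_lt _ _ h

theorem eq_zero_of_orthogonal_monicOrthogonal {g : ℝ[X]} {n : ℕ}
    (hg : ∀ k < n, B g (monicOrthogonal B k) = 0) :
    ∀ f : ℝ[X], f.degree < (n : WithBot ℕ) → B g f = 0 := by
  induction n with
  | zero =>
    intro f hf
    have : f = 0 := by simpa using hf
    rw [this, hB.zero_right]
  | succ n ih =>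
    intro f hf
    have h1 : f = (f - C (f.coeff n) * monicOrthogonal B n)
        + C (f.coeff n) * monicOrthogonal B n := by ring
    have hn : (monicOrthogonal B n).natDegree = n :=
      natDegree_eq_of_degree_eq_some (degree_monicOrthogonal B n)
    have hc : (monicOrthogonal B n).coeff n = 1 := by
      have := monic_monicOrthogonal B n
      rwa [Monic, leadingCoeff, hn] at this
    rw [h1, hB.add_right, hB.smul_right, hg n n.lt_succ_self, mul_zero, add_zero]
    refine ih (fun k hk => hg k (hk.trans n.lt_succ_self)) _ ?_
    rw [degree_lt_iff_coeff_zero]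
    intro k hk
    rcases hk.eq_or_lt with rfl | hk
    · simp [hc]
    · rw [coeff_sub, coeff_C_mul, (degree_lt_iff_coeff_zero _ _).1 hf k hk,
        coeff_eq_zero_of_natDegree_lt (hn.trans_lt hk)]
      simp

theorem monicOrthogonal_orthogonal_of_degree_lt {n : ℕ} {f : ℝ[X]} (hf : f.degree < (n : WithBot ℕ)) :
    B (monicOrthogonal B n) f = 0 :=
  hB.eq_zero_of_orthogonal_monicOrthogonal (hB.monicOrthogonal_orthogonal_of_lt n) f hf

theorem eq_zero_of_degree_lt {n : ℕ} {f : ℝ[X]} (hf : f.degree < (n : WithBot ℕ))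
    (h : ∀ k < n, B f (monicOrthogonal B k) = 0) : f = 0 := by
  by_contra hne
  exact (hB.pos f hne).ne' (hB.eq_zero_of_orthogonal_monicOrthogonal h f hf)

theorem monicOrthogonal_eq_self_of_monic {n : ℕ} {f : ℝ[X]}
    (hf : (f - X ^ n).degree < (n : WithBot ℕ)) :
    B (monicOrthogonal B n) f = B (monicOrthogonal B n) (monicOrthogonal B n) := by
  have h1 : (f - monicOrthogonal B n).degree < (n : WithBot ℕ) := by
    have : f - monicOrthogonal B n = (f - X ^ n) - (monicOrthogonal B n - X ^ n) := by ring
    rw [this]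
    exact (degree_sub_le _ _).trans_lt (max_lt hf (degree_monicOrthogonal_sub_lt B n))
  have h2 := hB.monicOrthogonal_orthogonal_of_degree_lt h1
  rw [hB.sub_right] at h2
  linarith

/-- The monic orthogonal polynomial has the least norm among monic polynomials of its degree. -/
theorem monicOrthogonal_self_le {n : ℕ} {f : ℝ[X]} (hf : (f - X ^ n).degree < (n : WithBot ℕ)) :
    B (monicOrthogonal B n) (monicOrthogonal B n) ≤ B f f := by
  have h0 := hB.nonneg (f - monicOrthogonal B n)
  have h1 := hB.monicOrthogonal_eq_self_of_monic hf
  rw [hB.sub_left, hB.sub_right, hB.sub_right, hB.symm f (monicOrthogonal B n), h1] at h0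
  linarith

end IsInnerProduct

theorem integrableOn_polynomial_laguerreWeight {α : ℝ} (hα : -1 < α) (p : ℝ[X]) :
    IntegrableOn (fun x => p.eval x * (x ^ α * Real.exp (-x))) (Set.Ioi 0) := by
  induction p using Polynomial.induction_on' with
  | add p q hp hq =>
    simp only [eval_add, add_mul]
    exact hp.add hq
  | monomial n a =>
    have h := (Real.GammaIntegral_convergent (s := n + α + 1)
      (by have : (0 : ℝ) ≤ n := n.cast_nonneg
          linarith)).const_mul a
    refine IntegrableOn.congr_fun h (fun x hx => ?_) measurableSet_Ioi
    have hx : 0 < x := hx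
    simp only [eval_monomial]
    rw [add_sub_cancel_right, Real.rpow_add hx, Real.rpow_natCast]
    ring

/-- The linear functional `p ↦ ∫₀^∞ p(x) x^α e^{-x} dx`. -/
noncomputable def laguerreFunctional (α : ℝ) (p : ℝ[X]) : ℝ :=
  ∫ x in Set.Ioi (0 : ℝ), p.eval x * (x ^ α * Real.exp (-x))

theorem laguerreInner_eq (α : ℝ) (f g : ℝ[X]) :
    laguerreInner α f g = laguerreFunctional α (f * g) := by
  simp only [laguerreInner, laguerreFunctional, eval_mul, mul_assoc]

theorem laguerreFunctional_add {α : ℝ} (hα : -1 < α) (p q : ℝ[X]) :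
    laguerreFunctional α (p + q) = laguerreFunctional α p + laguerreFunctional α q := by
  simp only [laguerreFunctional, eval_add, add_mul]
  exact integral_add (integrableOn_polynomial_laguerreWeight hα p)
    (integrableOn_polynomial_laguerreWeight hα q)

theorem laguerreFunctional_C_mul (α a : ℝ) (p : ℝ[X]) :
    laguerreFunctional α (C a * p) = a * laguerreFunctional α p := by
  simp only [laguerreFunctional, eval_mul, eval_C, mul_assoc]
  exact integral_const_mul _ _

theorem laguerreFunctional_monomial {α : ℝ} (hα : -1 < α) (n : ℕ) (a : ℝ) :
    laguerreFunctional α (monomial n a) = a * Real.Gamma (n + α + 1) := by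
  have h0 : (0 : ℝ) < n + α + 1 := by
    have : (0 : ℝ) ≤ n := n.cast_nonneg
    linarith
  rw [Real.Gamma_eq_integral h0, laguerreFunctional, ← integral_const_mul]
  refine setIntegral_congr_fun measurableSet_Ioi fun x hx => ?_
  have hx : 0 < x := hx
  simp only [eval_monomial]
  rw [add_sub_cancel_right, Real.rpow_add hx, Real.rpow_natCast]
  ring

theorem laguerreFunctional_pos {α : ℝ} (hα : -1 < α) {f : ℝ[X]} (hf : f ≠ 0) :
    0 < laguerreFunctional α (f * f) := by
  have hnn : ∀ x ∈ Set.Ioi (0 : ℝ), 0 ≤ (f * f).eval x * (x ^ α * Real.exp (-x)) := by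
    intro x hx
    have hx : 0 < x := hx
    rw [eval_mul]
    exact mul_nonneg (mul_self_nonneg _) (by positivity)
  rw [laguerreFunctional, setIntegral_pos_iff_support_of_nonneg_ae
    ((ae_restrict_iff' measurableSet_Ioi).2 (Eventually.of_forall hnn))
    (integrableOn_polynomial_laguerreWeight hα _)]
  have hsub : Set.Ioi (0 : ℝ) \ {x | f.IsRoot x} ⊆
      Function.support (fun x => (f * f).eval x * (x ^ α * Real.exp (-x))) ∩ Set.Ioi 0 := by
    rintro x ⟨hx, hr⟩
    have hx' : 0 < x := hx
    refine ⟨?_, hx⟩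
    rw [Function.mem_support, eval_mul]
    have : f.eval x ≠ 0 := hr
    positivity
  refine lt_of_lt_of_le ?_ (measure_mono hsub)
  rw [measure_sdiff_null ((finite_setOfPred_isRoot hf).measure_zero _)]
  simp

/-- Integration by parts against the Laguerre weight. -/
theorem laguerreFunctional_derivative {α : ℝ} (hα : -1 < α) (p : ℝ[X]) :
    laguerreFunctional α (X * derivative p + (C (α + 1) - X) * p) = 0 := by
  induction p using Polynomial.induction_on' with
  | add p q hp hq =>
    have : X * derivative (p + q) + (C (α + 1) - X) * (p + q) =
        (X * derivative p + (C (α + 1) - X) * p) + (X * derivative q + (C (α + 1) - X) * q) := by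
      rw [derivative_add]; ring
    rw [this, laguerreFunctional_add hα, hp, hq, add_zero]
  | monomial n a =>
    have : X * derivative (monomial n a) + (C (α + 1) - X) * monomial n a =
        monomial n (a * (n + α + 1)) + monomial (n + 1) (-a) := by
      simp only [← C_mul_X_pow_eq_monomial, derivative_C_mul_X_pow]
      rcases n with _ | n
      · simp; ring
      · simp; ring
    have hne : (n : ℝ) + α + 1 ≠ 0 := by
      have : (0 : ℝ) ≤ n := n.cast_nonneg
      linarith
    rw [this, laguerreFunctional_add hα, laguerreFunctional_monomial hα, laguerreFunctional_monomial hα]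
    have h : ((n + 1 : ℕ) : ℝ) + α + 1 = (n + α + 1) + 1 := by push_cast; ring
    rw [h, Real.Gamma_add_one hne]
    ring

theorem isInnerProduct_laguerreInner {α : ℝ} (hα : -1 < α) :
    IsInnerProduct (laguerreInner α) where
  symm f g := by rw [laguerreInner_eq, laguerreInner_eq, mul_comm]
  add_left f g h := by
    simp only [laguerreInner_eq, add_mul]
    exact laguerreFunctional_add hα _ _
  smul_left a f h := by
    simp only [laguerreInner_eq, mul_assoc]
    exact laguerreFunctional_C_mul _ _ _
  pos f hf := by
    rw [laguerreInner_eq]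
    exact laguerreFunctional_pos hα hf

theorem isInnerProduct_sobolevInner {α M N : ℝ} (hα : -1 < α) (hM : 0 ≤ M) (hN : 0 ≤ N) (c : ℝ) :
    IsInnerProduct (sobolevInner α M N c) where
  symm f g := by
    rw [sobolevInner, sobolevInner, (isInnerProduct_laguerreInner hα).symm f]
    ring
  add_left f g h := by
    simp only [sobolevInner, (isInnerProduct_laguerreInner hα).add_left, derivative_add, eval_add]
    ring
  smul_left a f h := by
    simp only [sobolevInner, (isInnerProduct_laguerreInner hα).smul_left, derivative_C_mul,
      eval_mul, eval_C]
    ring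
  pos f hf := by
    have h1 := (isInnerProduct_laguerreInner hα).pos f hf
    have h2 := mul_nonneg hM (mul_self_nonneg (f.eval c))
    have h3 := mul_nonneg hN (mul_self_nonneg ((derivative f).eval c))
    rw [sobolevInner]
    linarith

theorem laguerreInner_le_sobolevInner {M N : ℝ} (α : ℝ) (hM : 0 ≤ M) (hN : 0 ≤ N) (c : ℝ)
    (f : ℝ[X]) : laguerreInner α f f ≤ sobolevInner α M N c f f := by
  have h2 := mul_nonneg hM (mul_self_nonneg (f.eval c))
  have h3 := mul_nonneg hN (mul_self_nonneg ((derivative f).eval c))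
  rw [sobolevInner]
  linarith

theorem laguerreInner_X_mul_derivative {α : ℝ} (hα : -1 < α) (f g : ℝ[X]) :
    laguerreInner α (X * derivative f) g = laguerreInner α f (X * g)
      - (α + 1) * laguerreInner α f g - laguerreInner α f (X * derivative g) := by
  have h := laguerreFunctional_derivative hα (f * g)
  simp only [laguerreInner_eq]
  have e : (X * derivative (f * g) + (C (α + 1) - X) * (f * g)) + f * (X * g) =
      (X * derivative f * g + f * (X * derivative g)) + C (α + 1) * (f * g) := by
    rw [derivative_mul]; ring
  have h2 := congrArg (laguerreFunctional α) e
  rw [laguerreFunctional_add hα _ (f * (X * g)), h, laguerreFunctional_add hα, laguerreFunctional_add hα,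
    laguerreFunctional_C_mul] at h2
  linarith

/-- The Laguerre differential operator `f ↦ x f'' + (α + 1 - x) f'`. -/
noncomputable def laguerreOperator (α : ℝ) (f : ℝ[X]) : ℝ[X] :=
  X * derivative (derivative f) + (C (α + 1) - X) * derivative f

theorem laguerreInner_laguerreOperator {α : ℝ} (hα : -1 < α) (f g : ℝ[X]) :
    laguerreInner α (laguerreOperator α f) g =
      -laguerreFunctional α (X * derivative f * derivative g) := by
  have h := laguerreFunctional_derivative hα (derivative f * g)
  have e : X * derivative (derivative f * g) + (C (α + 1) - X) * (derivative f * g) =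
      laguerreOperator α f * g + X * derivative f * derivative g := by
    rw [derivative_mul, laguerreOperator]; ring
  rw [e, laguerreFunctional_add hα] at h
  rw [laguerreInner_eq]
  linarith

theorem laguerreInner_laguerreOperator_comm {α : ℝ} (hα : -1 < α) (f g : ℝ[X]) :
    laguerreInner α (laguerreOperator α f) g = laguerreInner α f (laguerreOperator α g) := by
  rw [(isInnerProduct_laguerreInner hα).symm f, laguerreInner_laguerreOperator hα,
    laguerreInner_laguerreOperator hα]
  congr 2
  ring

theorem coeff_X_mul_derivative (f : ℝ[X]) (k : ℕ) :
    (X * derivative f).coeff k = k * f.coeff k := by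
  rcases k with _ | k
  · simp
  · rw [coeff_X_mul, coeff_derivative]; push_cast; ring

theorem coeff_laguerreOperator (α : ℝ) (f : ℝ[X]) (k : ℕ) :
    (laguerreOperator α f).coeff k = (k + 1) * (k + 1 + α) * f.coeff (k + 1) - k * f.coeff k := by
  rw [laguerreOperator, sub_mul, coeff_add, coeff_sub, coeff_C_mul, coeff_X_mul_derivative,
    coeff_X_mul_derivative, coeff_derivative]
  ring

section

variable {α : ℝ} (hα : -1 < α)

theorem degree_monicLaguerre (α : ℝ) (n : ℕ) : (monicLaguerre α n).degree = n :=
  degree_monicOrthogonal _ n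

theorem coeff_monicLaguerre_self (α : ℝ) (n : ℕ) : (monicLaguerre α n).coeff n = 1 := by
  have h : (monicLaguerre α n).Monic := monic_monicOrthogonal _ n
  rwa [Monic, leadingCoeff, natDegree_eq_of_degree_eq_some (degree_monicLaguerre α n)] at h

theorem coeff_monicLaguerre_of_lt (α : ℝ) {n k : ℕ} (h : n < k) :
    (monicLaguerre α n).coeff k = 0 :=
  coeff_eq_zero_of_degree_lt (by rw [degree_monicLaguerre]; exact_mod_cast h)

include hα

theorem laguerreNormSq_monicLaguerre_pos (n : ℕ) : 0 < laguerreNormSq α (monicLaguerre α n) :=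
  (isInnerProduct_laguerreInner hα).monicOrthogonal_self_pos n

theorem laguerreInner_monicLaguerre_of_ne {m n : ℕ} (h : m ≠ n) :
    laguerreInner α (monicLaguerre α m) (monicLaguerre α n) = 0 :=
  (isInnerProduct_laguerreInner hα).monicOrthogonal_orthogonal h

theorem laguerreInner_monicLaguerre_of_degree_lt {n : ℕ} {f : ℝ[X]}
    (h : f.degree < (n : WithBot ℕ)) : laguerreInner α (monicLaguerre α n) f = 0 :=
  (isInnerProduct_laguerreInner hα).monicOrthogonal_orthogonal_of_degree_lt h

/-- The Laguerre differential equation. -/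
theorem laguerreOperator_monicLaguerre (n : ℕ) :
    laguerreOperator α (monicLaguerre α n) = -(C (n : ℝ) * monicLaguerre α n) := by
  have hB := isInnerProduct_laguerreInner hα
  rw [← add_eq_zero_iff_eq_neg]
  refine hB.eq_zero_of_degree_lt (n := n) ?_ fun k hk => ?_
  · rw [degree_lt_iff_coeff_zero]
    intro k hk
    rw [coeff_add, coeff_laguerreOperator, coeff_C_mul,
      coeff_monicLaguerre_of_lt α (Nat.lt_succ_of_le hk)]
    rcases hk.eq_or_lt with rfl | hk
    · ring
    · rw [coeff_monicLaguerre_of_lt α hk]; ring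
  · change laguerreInner α _ (monicLaguerre α k) = 0
    rw [hB.add_left, hB.smul_left, laguerreInner_monicLaguerre_of_ne hα hk.ne',
      laguerreInner_laguerreOperator_comm hα, laguerreInner_monicLaguerre_of_degree_lt hα]
    · ring
    · rw [degree_lt_iff_coeff_zero]
      intro j hj
      rw [coeff_laguerreOperator, coeff_monicLaguerre_of_lt α (hk.trans_le hj),
        coeff_monicLaguerre_of_lt α (Nat.lt_succ_of_lt (hk.trans_le hj))]
      ring

theorem coeff_monicLaguerre_succ (n : ℕ) :
    (monicLaguerre α (n + 1)).coeff n = -((n + 1) * (n + 1 + α)) := by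
  have h := congrArg (fun p => coeff p n) (laguerreOperator_monicLaguerre hα (n + 1))
  simp only [coeff_laguerreOperator, coeff_neg, coeff_C_mul, coeff_monicLaguerre_self] at h
  push_cast at h
  linarith

theorem X_mul_derivative_monicLaguerre_succ (n : ℕ) :
    X * derivative (monicLaguerre α (n + 1)) = C ((n : ℝ) + 1) * monicLaguerre α (n + 1)
      + C (laguerreNormSq α (monicLaguerre α (n + 1)) / laguerreNormSq α (monicLaguerre α n))
        * monicLaguerre α n := by
  have hB := isInnerProduct_laguerreInner hα
  have hpos := laguerreNormSq_monicLaguerre_pos hα n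
  rw [← sub_eq_zero]
  refine hB.eq_zero_of_degree_lt (n := n + 1) ?_ fun k hk => ?_
  · rw [degree_lt_iff_coeff_zero]
    intro k hk
    rw [coeff_sub, coeff_add, coeff_X_mul_derivative, coeff_C_mul, coeff_C_mul,
      coeff_monicLaguerre_of_lt α (Nat.lt_of_succ_le hk)]
    rcases hk.eq_or_lt with rfl | hk
    · push_cast; ring
    · rw [coeff_monicLaguerre_of_lt α hk]; ring
  · change laguerreInner α _ (monicLaguerre α k) = 0
    have h0 : laguerreInner α (monicLaguerre α (n + 1)) (X * derivative (monicLaguerre α k)) = 0 := by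
      refine laguerreInner_monicLaguerre_of_degree_lt hα ?_
      rw [degree_lt_iff_coeff_zero]
      intro j hj
      rw [coeff_X_mul_derivative, coeff_monicLaguerre_of_lt α (hk.trans_le hj), mul_zero]
    rw [hB.sub_left, hB.add_left, hB.smul_left, hB.smul_left, laguerreInner_X_mul_derivative hα, h0,
      laguerreInner_monicLaguerre_of_ne hα hk.ne']
    rcases (Nat.lt_succ_iff.1 hk).eq_or_lt with rfl | hk'
    · have h1 : laguerreInner α (monicLaguerre α (k + 1)) (X * monicLaguerre α k)
          = laguerreNormSq α (monicLaguerre α (k + 1)) := by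
        refine hB.monicOrthogonal_eq_self_of_monic ?_
        rw [degree_lt_iff_coeff_zero]
        intro j hj
        obtain ⟨j, rfl⟩ : ∃ i, j = i + 1 := ⟨j - 1, by omega⟩
        rw [coeff_sub, coeff_X_mul, coeff_X_pow]
        rcases (Nat.le_of_succ_le_succ hj).eq_or_lt with rfl | hj
        · simp [coeff_monicLaguerre_self]
        · rw [coeff_monicLaguerre_of_lt α hj, if_neg (by omega), sub_zero]
      rw [h1]
      change _ - (_ + _ * laguerreNormSq α (monicLaguerre α k)) = _
      field_simp
      ring
    · rw [laguerreInner_monicLaguerre_of_ne hα hk'.ne', laguerreInner_monicLaguerre_of_degree_lt hα]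
      · ring
      · rw [degree_lt_iff_coeff_zero]
        intro j hj
        obtain ⟨j, rfl⟩ : ∃ i, j = i + 1 := ⟨j - 1, by omega⟩
        rw [coeff_X_mul, coeff_monicLaguerre_of_lt α (by omega)]

theorem laguerreNormSq_monicLaguerre_succ (n : ℕ) :
    laguerreNormSq α (monicLaguerre α (n + 1)) =
      (n + 1) * (n + 1 + α) * laguerreNormSq α (monicLaguerre α n) := by
  have hpos := laguerreNormSq_monicLaguerre_pos hα n
  have h := congrArg (fun p => coeff p n) (X_mul_derivative_monicLaguerre_succ hα n)
  simp only [coeff_add, coeff_C_mul, coeff_X_mul_derivative, coeff_monicLaguerre_self,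
    coeff_monicLaguerre_succ hα] at h
  field_simp at h
  linarith

theorem X_mul_derivative_monicLaguerre (n : ℕ) :
    X * derivative (monicLaguerre α (n + 1)) = C ((n : ℝ) + 1) * monicLaguerre α (n + 1)
      + C ((n + 1) * (n + 1 + α)) * monicLaguerre α n := by
  have hpos := laguerreNormSq_monicLaguerre_pos hα n
  rw [X_mul_derivative_monicLaguerre_succ hα, laguerreNormSq_monicLaguerre_succ hα,
    mul_div_cancel_right₀ _ hpos.ne']

theorem derivative_monicLaguerre_succ (n : ℕ) :
    derivative (monicLaguerre α (n + 1)) =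
      C ((n : ℝ) + 1) * (monicLaguerre α n - derivative (monicLaguerre α n)) := by
  have h1 := X_mul_derivative_monicLaguerre hα n
  have h2 := congrArg derivative h1
  have h3 := laguerreOperator_monicLaguerre hα (n + 1)
  have hne : (n : ℝ) + 1 + α ≠ 0 := by
    have : (0 : ℝ) ≤ n := n.cast_nonneg
    linarith
  refine mul_left_cancel₀ (C_ne_zero.2 hne) ?_
  rw [laguerreOperator] at h3
  simp only [derivative_add, derivative_mul, derivative_X, derivative_C, zero_mul, zero_add,
    one_mul] at h2
  simp only [C_add, C_mul, C_1, Nat.cast_add, Nat.cast_one] at *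
  linear_combination h1 + h3 - h2

theorem laguerreNormSq_monicLaguerre (n : ℕ) :
    laguerreNormSq α (monicLaguerre α n) = Real.Gamma ((n : ℝ) + 1) * Real.Gamma ((n : ℝ) + α + 1) := by
  induction n with
  | zero =>
    have h0 : monicLaguerre α 0 = 1 := by
      rw [monicLaguerre, monicOrthogonal_eq]; simp
    rw [h0, laguerreNormSq, laguerreInner_eq, mul_one, ← monomial_zero_one,
      laguerreFunctional_monomial hα]
    simp
  | succ n ih =>
    have hn : (0 : ℝ) ≤ n := n.cast_nonneg
    rw [laguerreNormSq_monicLaguerre_succ hα, ih]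
    have e : ((n + 1 : ℕ) : ℝ) + α + 1 = (n + α + 1) + 1 := by push_cast; ring
    rw [e, Real.Gamma_add_one (by linarith : (n : ℝ) + α + 1 ≠ 0), Nat.cast_add_one,
      Real.Gamma_add_one (by positivity : (n : ℝ) + 1 ≠ 0)]
    ring

end

theorem laguerreFunctional_X_mul_derivative_sq {α : ℝ} (hα : -1 < α) (n : ℕ) :
    laguerreFunctional α (X * derivative (monicLaguerre α n) * derivative (monicLaguerre α n))
      = n * laguerreNormSq α (monicLaguerre α n) := by
  have hB := isInnerProduct_laguerreInner hα
  have h := laguerreInner_laguerreOperator hα (monicLaguerre α n) (monicLaguerre α n)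
  rw [laguerreOperator_monicLaguerre hα, ← neg_one_mul, ← mul_assoc, ← C_1, ← C_neg, ← C_mul,
    hB.smul_left] at h
  rw [laguerreNormSq]
  linarith

/-- The Sonin-type energy `n y² + x y'²` of the monic Laguerre polynomial `y` of degree `n`. -/
noncomputable def laguerreEnergy (α : ℝ) (n : ℕ) : ℝ[X] :=
  C (n : ℝ) * (monicLaguerre α n * monicLaguerre α n)
    + X * derivative (monicLaguerre α n) * derivative (monicLaguerre α n)

theorem derivative_laguerreEnergy {α : ℝ} (hα : -1 < α) (n : ℕ) :
    derivative (laguerreEnergy α n) =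
      (C 2 * X - C (2 * α + 1)) * derivative (monicLaguerre α n) ^ 2 := by
  have h := laguerreOperator_monicLaguerre hα n
  rw [laguerreOperator] at h
  simp only [laguerreEnergy, derivative_add, derivative_mul, derivative_X, derivative_C, zero_mul,
    zero_add, one_mul]
  simp only [C_add, C_mul, C_1, C_ofNat] at *
  linear_combination 2 * derivative (monicLaguerre α n) * h

theorem eval_laguerreEnergy (α : ℝ) (n : ℕ) (x : ℝ) :
    (laguerreEnergy α n).eval x = n * (monicLaguerre α n).eval x ^ 2
      + x * (derivative (monicLaguerre α n)).eval x ^ 2 := by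
  simp only [laguerreEnergy, eval_add, eval_mul, eval_C, eval_X]
  ring

theorem eval_laguerreEnergy_nonneg (α : ℝ) (n : ℕ) {x : ℝ} (hx : 0 ≤ x) :
    0 ≤ (laguerreEnergy α n).eval x := by
  rw [eval_laguerreEnergy]
  positivity

theorem laguerreFunctional_laguerreEnergy {α : ℝ} (hα : -1 < α) (n : ℕ) :
    laguerreFunctional α (laguerreEnergy α n) =
      2 * (n * laguerreNormSq α (monicLaguerre α n)) := by
  rw [laguerreEnergy, laguerreFunctional_add hα, laguerreFunctional_C_mul,
    laguerreFunctional_X_mul_derivative_sq hα, ← laguerreInner_eq, ← laguerreNormSq]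
  ring

theorem eval_laguerreEnergy_mul_exp_le {α c : ℝ} (hα : -1 < α) (hc : 0 < c) (n : ℕ) {x : ℝ}
    (hx : x ∈ Set.Icc (c / 2) c) :
    (laguerreEnergy α n).eval c * Real.exp (-(2 * (2 * c + 1) / c * c)) ≤
      (laguerreEnergy α n).eval x := by
  set K : ℝ := 2 * (2 * c + 1) / c with hK
  have hKpos : 0 < K := by positivity
  have hanti : AntitoneOn (fun x => (laguerreEnergy α n).eval x * Real.exp (-(K * x)))
      (Set.Icc (c / 2) c) := by
    have hd : ∀ x : ℝ, HasDerivAt (fun x => (laguerreEnergy α n).eval x * Real.exp (-(K * x)))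
        ((derivative (laguerreEnergy α n)).eval x * Real.exp (-(K * x))
          + (laguerreEnergy α n).eval x * (Real.exp (-(K * x)) * (-(K * 1)))) x := fun x =>
      ((laguerreEnergy α n).hasDerivAt x).mul (((hasDerivAt_id x).const_mul K).neg.exp)
    refine antitoneOn_of_deriv_nonpos (convex_Icc _ _)
      (fun x _ => (hd x).continuousAt.continuousWithinAt)
      (fun x _ => (hd x).differentiableAt.differentiableWithinAt) fun x hx => ?_
    rw [interior_Icc] at hx
    obtain ⟨hx1, hx2⟩ := hx
    have hx0 : 0 < x := by linarith
    rw [(hd x).deriv, derivative_laguerreEnergy hα, eval_laguerreEnergy]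
    simp only [eval_mul, eval_sub, eval_C, eval_X, eval_pow]
    set y := (monicLaguerre α n).eval x
    set z := (derivative (monicLaguerre α n)).eval x
    have h1 : 2 * x - (2 * α + 1) ≤ K * x := by
      have : 2 * c + 1 ≤ K * x := by
        rw [hK, div_mul_eq_mul_div, le_div_iff₀ hc]
        nlinarith
      linarith
    have h2 : (2 * x - (2 * α + 1)) * z ^ 2 ≤ K * (n * y ^ 2 + x * z ^ 2) := by
      have h3 := mul_le_mul_of_nonneg_right h1 (sq_nonneg z)
      have h4 : 0 ≤ K * (n * y ^ 2) := by positivity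
      linarith
    have h5 := mul_le_mul_of_nonneg_right h2 (Real.exp_pos (-(K * x))).le
    linarith
  have h := hanti hx (Set.right_mem_Icc.2 (by linarith)) hx.2
  refine h.trans (mul_le_of_le_one_right (eval_laguerreEnergy_nonneg α n ?_) ?_)
  · linarith [hx.1]
  · have : 0 < x := by linarith [hx.1]
    rw [Real.exp_le_one_iff]
    have := mul_pos hKpos this
    linarith

theorem exists_eval_laguerreEnergy_le {α c : ℝ} (hα : -1 < α) (hc : 0 < c) :
    ∃ K : ℝ, 0 < K ∧ ∀ n : ℕ,
      (laguerreEnergy α n).eval c ≤ K * (n * laguerreNormSq α (monicLaguerre α n)) := by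
  set E := Real.exp (-(2 * (2 * c + 1) / c * c))
  have hE : 0 < E := Real.exp_pos _
  set w : ℝ → ℝ := fun x => x ^ α * Real.exp (-x) with hw
  have hsub : Set.Ioc (c / 2) c ⊆ Set.Ioi 0 := fun x hx => by
    have h := hx.1
    change 0 < x
    linarith
  have hwint : IntegrableOn w (Set.Ioi 0) := by
    simpa using integrableOn_polynomial_laguerreWeight hα 1
  have hwpos : ∀ x ∈ Set.Ioi (0 : ℝ), 0 < w x := fun x hx => by
    have hx : 0 < x := hx
    simp only [hw]
    positivity
  have hI : 0 < ∫ x in Set.Ioc (c / 2) c, w x := by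
    rw [setIntegral_pos_iff_support_of_nonneg_ae
      ((ae_restrict_iff' measurableSet_Ioc).2
        (Eventually.of_forall fun x hx => (hwpos x (hsub hx)).le)) (hwint.mono_set hsub)]
    have hsupp : Set.Ioc (c / 2) c ⊆ Function.support w := fun x hx => (hwpos x (hsub hx)).ne'
    rw [Set.inter_eq_right.2 hsupp]
    simpa using hc
  set I := ∫ x in Set.Ioc (c / 2) c, w x
  refine ⟨2 / (E * I), by positivity, fun n => ?_⟩
  have hint := integrableOn_polynomial_laguerreWeight hα (laguerreEnergy α n)
  have h1 : (laguerreEnergy α n).eval c * E * I ≤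
      ∫ x in Set.Ioc (c / 2) c, (laguerreEnergy α n).eval x * w x := by
    rw [← integral_const_mul]
    refine setIntegral_mono_on ((hwint.mono_set hsub).const_mul _) (hint.mono_set hsub)
      measurableSet_Ioc fun x hx => ?_
    exact mul_le_mul_of_nonneg_right
      (eval_laguerreEnergy_mul_exp_le hα hc n (Set.Ioc_subset_Icc_self hx)) (hwpos x (hsub hx)).le
  have h2 : ∫ x in Set.Ioc (c / 2) c, (laguerreEnergy α n).eval x * w x ≤
      laguerreFunctional α (laguerreEnergy α n) := by
    refine setIntegral_mono_set hint ((ae_restrict_iff' measurableSet_Ioi).2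
      (Eventually.of_forall fun x hx => ?_)) (LE.le.eventuallyLE hsub)
    exact mul_nonneg (eval_laguerreEnergy_nonneg α n (le_of_lt hx)) (hwpos x hx).le
  rw [laguerreFunctional_laguerreEnergy hα] at h2
  rw [div_mul_eq_mul_div, le_div_iff₀ (by positivity)]
  linarith

/-- The classical Laguerre polynomial `L_n = (-1)^n P_n / n!`, with `P_n` monic. -/
noncomputable def laguerrePoly (α : ℝ) (n : ℕ) : ℝ[X] :=
  C ((-1) ^ n / (n.factorial : ℝ)) * monicLaguerre α n

section

variable {α : ℝ} (hα : -1 < α)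

theorem coeff_laguerrePoly_self (α : ℝ) (n : ℕ) :
    (laguerrePoly α n).coeff n = (-1) ^ n / n.factorial := by
  rw [laguerrePoly, coeff_C_mul, coeff_monicLaguerre_self, mul_one]

theorem coeff_laguerrePoly_of_lt (α : ℝ) {n k : ℕ} (h : n < k) :
    (laguerrePoly α n).coeff k = 0 := by
  rw [laguerrePoly, coeff_C_mul, coeff_monicLaguerre_of_lt α h, mul_zero]

include hα

theorem laguerreNormSq_laguerrePoly (n : ℕ) :
    laguerreNormSq α (laguerrePoly α n) =
      laguerreNormSq α (monicLaguerre α n) / (n.factorial : ℝ) ^ 2 := by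
  have hB := isInnerProduct_laguerreInner hα
  have h1 : ((-1 : ℝ) ^ n) ^ 2 = 1 := by rw [← pow_mul, mul_comm, pow_mul]; simp
  rw [laguerreNormSq, laguerrePoly, hB.smul_left, hB.smul_right, ← mul_assoc, ← sq, div_pow, h1,
    laguerreNormSq]
  ring

theorem laguerreNormSq_laguerrePoly_pos (n : ℕ) : 0 < laguerreNormSq α (laguerrePoly α n) := by
  rw [laguerreNormSq_laguerrePoly hα]
  have := laguerreNormSq_monicLaguerre_pos hα n
  positivity

theorem laguerreInner_laguerrePoly_of_ne {m n : ℕ} (h : m ≠ n) :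
    laguerreInner α (laguerrePoly α m) (laguerrePoly α n) = 0 := by
  have hB := isInnerProduct_laguerreInner hα
  rw [laguerrePoly, laguerrePoly, hB.smul_left, hB.smul_right,
    laguerreInner_monicLaguerre_of_ne hα h]
  ring

theorem laguerreNormSq_laguerrePoly_succ (n : ℕ) :
    laguerreNormSq α (laguerrePoly α (n + 1)) =
      (1 + α / (n + 1)) * laguerreNormSq α (laguerrePoly α n) := by
  rw [laguerreNormSq_laguerrePoly hα, laguerreNormSq_laguerrePoly hα,
    laguerreNormSq_monicLaguerre_succ hα, Nat.factorial_succ]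
  push_cast
  field_simp

theorem derivative_laguerrePoly_succ (n : ℕ) :
    derivative (laguerrePoly α (n + 1)) =
      derivative (laguerrePoly α n) - laguerrePoly α n := by
  have h : ((-1 : ℝ) ^ (n + 1) / (n + 1).factorial) * (n + 1) = -((-1) ^ n / n.factorial) := by
    rw [Nat.factorial_succ, pow_succ]
    push_cast
    field_simp
  rw [laguerrePoly, laguerrePoly, derivative_C_mul, derivative_C_mul,
    derivative_monicLaguerre_succ hα, ← mul_assoc, ← C_mul, h, C_neg]
  ring

theorem X_mul_derivative_laguerrePoly_succ (n : ℕ) :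
    X * derivative (laguerrePoly α (n + 1)) =
      C ((n : ℝ) + 1) * laguerrePoly α (n + 1) - C (n + 1 + α) * laguerrePoly α n := by
  have h : ((-1 : ℝ) ^ (n + 1) / (n + 1).factorial) * ((n + 1) * (n + 1 + α)) =
      -((n + 1 + α) * ((-1) ^ n / n.factorial)) := by
    rw [Nat.factorial_succ, pow_succ]
    push_cast
    field_simp
  rw [laguerrePoly, laguerrePoly, derivative_C_mul, mul_left_comm,
    X_mul_derivative_monicLaguerre hα, mul_add, ← mul_assoc _ (C ((n + 1) * (n + 1 + α))),
    ← C_mul, h, C_neg, C_mul]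
  ring

theorem exists_eval_laguerrePoly_le {c : ℝ} (hc : 0 < c) :
    ∃ K : ℝ, 0 < K ∧ ∀ n : ℕ,
      (laguerrePoly α (n + 1)).eval c ^ 2 ≤ K * laguerreNormSq α (laguerrePoly α (n + 1)) ∧
      c * (derivative (laguerrePoly α (n + 1))).eval c ^ 2 ≤
        K * (n + 1) * laguerreNormSq α (laguerrePoly α (n + 1)) := by
  obtain ⟨K, hK, h⟩ := exists_eval_laguerreEnergy_le hα hc
  refine ⟨K, hK, fun n => ?_⟩
  have h1 := h (n + 1)
  have hs : ((-1 : ℝ) ^ (n + 1)) ^ 2 = 1 := by rw [← pow_mul, mul_comm, pow_mul]; simp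
  rw [eval_laguerreEnergy, Nat.cast_add_one] at h1
  rw [laguerreNormSq_laguerrePoly hα, laguerrePoly, derivative_C_mul, eval_mul, eval_mul, eval_C,
    mul_pow, mul_pow, div_pow, hs]
  set y := (monicLaguerre α (n + 1)).eval c
  set z := (derivative (monicLaguerre α (n + 1))).eval c
  set H := laguerreNormSq α (monicLaguerre α (n + 1))
  have hn : (0 : ℝ) < n + 1 := by positivity
  have hy : y ^ 2 ≤ K * H := by
    refine le_of_mul_le_mul_left ?_ hn
    have : 0 ≤ c * z ^ 2 := by positivity
    linarith
  have hz : c * z ^ 2 ≤ K * (n + 1) * H := by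
    have : 0 ≤ (n + 1) * y ^ 2 := by positivity
    linarith
  have hf : (0 : ℝ) < ((n + 1).factorial : ℝ) ^ 2 := by positivity
  constructor
  · rw [mul_div_assoc', div_mul_eq_mul_div, one_mul]
    exact div_le_div_of_nonneg_right hy hf.le
  · rw [mul_div_assoc', div_mul_eq_mul_div, one_mul, mul_div_assoc']
    exact div_le_div_of_nonneg_right hz hf.le

theorem tendsto_laguerreNormSq_laguerrePoly_ratio (i : ℕ) :
    Tendsto (fun n => laguerreNormSq α (laguerrePoly α (n + i)) /
      laguerreNormSq α (laguerrePoly α n)) atTop (𝓝 1) := by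
  induction i with
  | zero =>
    refine tendsto_const_nhds.congr fun n => ?_
    rw [add_zero, div_self (laguerreNormSq_laguerrePoly_pos hα n).ne']
  | succ i ih =>
    have h1 : Tendsto (fun n : ℕ => 1 + α * (1 / (((n + i : ℕ) : ℝ) + 1))) atTop (𝓝 1) := by
      have := ((tendsto_one_div_add_atTop_nhds_zero_nat (𝕜 := ℝ)).comp
        (tendsto_add_atTop_nat i)).const_mul α |>.const_add 1
      simpa using this
    have h2 := h1.mul ih
    rw [mul_one] at h2
    refine h2.congr fun n => ?_
    rw [← add_assoc, laguerreNormSq_laguerrePoly_succ hα, mul_one_div, mul_div_assoc]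

theorem isBigO_sqrt_laguerreNormSq (i : ℕ) :
    (fun n => √(laguerreNormSq α (laguerrePoly α (n + i)))) =O[atTop]
      fun n => √(laguerreNormSq α (laguerrePoly α n)) := by
  have h := (tendsto_laguerreNormSq_laguerrePoly_ratio hα i).sqrt
  refine Asymptotics.isBigO_of_div_tendsto_nhds (Eventually.of_forall fun n hn => ?_) _
    (h.congr fun n => ?_)
  · exact absurd hn (Real.sqrt_pos.2 (laguerreNormSq_laguerrePoly_pos hα n)).ne'
  · rw [Pi.div_apply, Real.sqrt_div (laguerreNormSq_laguerrePoly_pos hα _).le]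

theorem isBigO_eval_laguerrePoly {c : ℝ} (hc : 0 < c) :
    (fun n => (laguerrePoly α n).eval c) =O[atTop]
      fun n => √(laguerreNormSq α (laguerrePoly α n)) := by
  obtain ⟨K, hK, h⟩ := exists_eval_laguerrePoly_le hα hc
  refine Asymptotics.IsBigO.of_bound (√K) ?_
  filter_upwards [eventually_ge_atTop 1] with n hn
  obtain ⟨n, rfl⟩ : ∃ i, n = i + 1 := ⟨n - 1, by omega⟩
  rw [Real.norm_eq_abs, Real.norm_eq_abs, abs_of_nonneg (Real.sqrt_nonneg _),
    ← Real.sqrt_mul hK.le]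
  exact Real.abs_le_sqrt (h n).1

theorem isLittleO_eval_derivative_laguerrePoly {c : ℝ} (hc : 0 < c) :
    (fun n : ℕ => (derivative (laguerrePoly α (n + 1))).eval c / ((n : ℝ) + 1)) =o[atTop]
      fun n => √(laguerreNormSq α (laguerrePoly α n)) := by
  obtain ⟨K, hK, h⟩ := exists_eval_laguerrePoly_le hα hc
  refine Asymptotics.IsLittleO.trans_isBigO ?_ (isBigO_sqrt_laguerreNormSq hα 1)
  refine Asymptotics.IsLittleO.of_pow (n := 2) ?_ two_ne_zero
  have h0 : Tendsto (fun n : ℕ => K / c * (1 / ((n : ℝ) + 1))) atTop (𝓝 0) := by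
    simpa using (tendsto_one_div_add_atTop_nhds_zero_nat (𝕜 := ℝ)).const_mul (K / c)
  refine Asymptotics.isLittleO_of_tendsto (fun n hn => ?_)
    (squeeze_zero (fun n => by simp only [Pi.pow_apply]; positivity) (fun n => ?_) h0)
  · simp only [Pi.pow_apply] at hn
    exact absurd hn (pow_pos (Real.sqrt_pos.2 (laguerreNormSq_laguerrePoly_pos hα _)) 2).ne'
  · have hp := laguerreNormSq_laguerrePoly_pos hα (n + 1)
    simp only [Pi.pow_apply]
    rw [Real.sq_sqrt hp.le, div_le_iff₀ hp, div_pow, div_le_iff₀ (by positivity)]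
    have h2 := (h n).2
    have e : K / c * (1 / ((n : ℝ) + 1)) * laguerreNormSq α (laguerrePoly α (n + 1))
        * ((n : ℝ) + 1) ^ 2
        = (K * (n + 1) * laguerreNormSq α (laguerrePoly α (n + 1))) / c := by
      field_simp
    rw [e, le_div_iff₀ hc]
    linarith

theorem isLittleO_eval_laguerrePoly_succ_sub {c : ℝ} (hc : 0 < c) :
    (fun n : ℕ => (laguerrePoly α (n + 1)).eval c - (laguerrePoly α n).eval c) =o[atTop]
      fun n => √(laguerreNormSq α (laguerrePoly α n)) := by
  have h1 := (isLittleO_eval_derivative_laguerrePoly hα hc).const_mul_left c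
  have h2 : (fun n : ℕ => α * (1 / ((n : ℝ) + 1)) * (laguerrePoly α n).eval c) =o[atTop]
      fun n => √(laguerreNormSq α (laguerrePoly α n)) := by
    have h0 : (fun n : ℕ => α * (1 / ((n : ℝ) + 1))) =o[atTop] fun _ => (1 : ℝ) := by
      rw [Asymptotics.isLittleO_one_iff]
      simpa using (tendsto_one_div_add_atTop_nhds_zero_nat (𝕜 := ℝ)).const_mul α
    simpa using h0.mul_isBigO (isBigO_eval_laguerrePoly hα hc)
  refine (h1.add h2).congr_left fun n => ?_
  have h := congrArg (eval c) (X_mul_derivative_laguerrePoly_succ hα n)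
  simp only [eval_mul, eval_sub, eval_C, eval_X] at h
  field_simp
  linarith

theorem isLittleO_eval_laguerrePoly_add_sub {c : ℝ} (hc : 0 < c) (i : ℕ) :
    (fun n : ℕ => (laguerrePoly α (n + i)).eval c - (laguerrePoly α n).eval c) =o[atTop]
      fun n => √(laguerreNormSq α (laguerrePoly α n)) := by
  induction i with
  | zero => simp
  | succ i ih =>
    have h := ((isLittleO_eval_laguerrePoly_succ_sub hα hc).comp_tendsto
      (tendsto_add_atTop_nat i)).trans_isBigO (isBigO_sqrt_laguerreNormSq hα i)
    refine (ih.add h).congr_left fun n => ?_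
    simp only [Function.comp_apply, add_assoc]
    ring

theorem isLittleO_eval_derivative_laguerrePoly_add {c : ℝ} (hc : 0 < c) (i : ℕ) :
    (fun n : ℕ => (derivative (laguerrePoly α (n + i))).eval c
      - (derivative (laguerrePoly α n)).eval c + i * (laguerrePoly α n).eval c) =o[atTop]
      fun n => √(laguerreNormSq α (laguerrePoly α n)) := by
  induction i with
  | zero => simp
  | succ i ih =>
    refine (ih.sub (isLittleO_eval_laguerrePoly_add_sub hα hc i)).congr_left fun n => ?_
    rw [← add_assoc, derivative_laguerrePoly_succ hα, eval_sub]
    push_cast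
    ring

end

theorem exists_extrapolation_weights {ε : ℝ} (hε : 0 < ε) :
    ∃ (m : ℕ) (a : ℕ → ℝ), ∑ i ∈ Finset.range m, a i = 1 ∧
      ∑ i ∈ Finset.range m, a i * i = m ∧ ∑ i ∈ Finset.range m, a i ^ 2 < ε := by
  obtain ⟨m, hm⟩ := exists_nat_gt (max 2 (10 / ε))
  obtain ⟨hm2, hmε⟩ := max_lt_iff.1 hm
  have s1 : ∀ k : ℕ, ∑ i ∈ Finset.range k, (i : ℝ) = k * (k - 1) / 2 := fun k => by
    induction k with
    | zero => simp
    | succ k ih => rw [Finset.sum_range_succ, ih]; push_cast; ring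
  have s2 : ∀ k : ℕ, ∑ i ∈ Finset.range k, (i : ℝ) ^ 2 = k * (k - 1) * (2 * k - 1) / 6 := fun k => by
    induction k with
    | zero => simp
    | succ k ih => rw [Finset.sum_range_succ, ih]; push_cast; ring
  have h0 : (0 : ℝ) < m := by linarith
  have h1 : (0 : ℝ) < m - 1 := by linarith
  set p : ℝ := 6 / (m * (m - 1)) with hp
  set q : ℝ := (2 - 2 * m) / (m * (m - 1)) with hq
  have t0 : ∑ i ∈ Finset.range m, (p * i + q) = 1 := by
    rw [Finset.sum_add_distrib, ← Finset.mul_sum, s1, Finset.sum_const, Finset.card_range,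
      nsmul_eq_mul, hp, hq]
    field_simp
    ring
  have t1 : ∑ i ∈ Finset.range m, (p * i + q) * i = m := by
    have e : ∀ i : ℕ, (p * i + q) * i = p * (i : ℝ) ^ 2 + q * i := fun i => by ring
    simp only [e]
    rw [Finset.sum_add_distrib, ← Finset.mul_sum, ← Finset.mul_sum, s1, s2, hp, hq]
    field_simp
    ring
  refine ⟨m, fun i => p * i + q, t0, t1, ?_⟩
  have e : ∀ i : ℕ, (p * i + q) ^ 2 = p * ((p * i + q) * i) + q * (p * i + q) := fun i => by ring
  simp only [e]
  rw [Finset.sum_add_distrib, ← Finset.mul_sum, ← Finset.mul_sum, t0, t1]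
  have h2 : p * m + q * 1 ≤ 10 / m := by
    rw [hp, hq, div_mul_eq_mul_div, mul_one, ← add_div, div_le_div_iff₀ (by positivity) h0]
    nlinarith
  refine h2.trans_lt ?_
  rw [div_lt_iff₀ h0]
  rw [div_lt_iff₀ hε] at hmε
  linarith

/-- The Laguerre polynomial `L_{n+m}` corrected by its `m` predecessors. -/
noncomputable def laguerreWindow (α : ℝ) (m : ℕ) (a : ℕ → ℝ) (n : ℕ) : ℝ[X] :=
  laguerrePoly α (n + m) - ∑ i ∈ Finset.range m, C (a i) * laguerrePoly α (n + i)

section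

variable {α : ℝ} (hα : -1 < α) {m : ℕ} {a : ℕ → ℝ}

theorem degree_laguerreWindow_sub_lt (α : ℝ) (m : ℕ) (a : ℕ → ℝ) (n : ℕ) :
    (C ((-1) ^ (n + m) * ((n + m).factorial : ℝ)) * laguerreWindow α m a n
      - X ^ (n + m)).degree < ((n + m : ℕ) : WithBot ℕ) := by
  rw [degree_lt_iff_coeff_zero]
  intro k hk
  have hs : (∑ i ∈ Finset.range m, C (a i) * laguerrePoly α (n + i)).coeff k = 0 := by
    rw [finsetSum_coeff]
    refine Finset.sum_eq_zero fun i hi => ?_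
    have := Finset.mem_range.1 hi
    rw [coeff_C_mul, coeff_laguerrePoly_of_lt α (by omega), mul_zero]
  rw [coeff_sub, coeff_C_mul, laguerreWindow, coeff_sub, hs, sub_zero, coeff_X_pow]
  rcases hk.eq_or_lt with rfl | hk
  · have h1 : ((-1 : ℝ) ^ (n + m)) * (-1) ^ (n + m) = 1 := by rw [← mul_pow]; simp
    rw [coeff_laguerrePoly_self, if_pos rfl]
    field_simp
    linarith
  · rw [coeff_laguerrePoly_of_lt α hk, if_neg hk.ne']
    ring

include hα

theorem laguerreInner_laguerreWindow (n : ℕ) :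
    laguerreInner α (laguerreWindow α m a n) (laguerreWindow α m a n) =
      laguerreNormSq α (laguerrePoly α (n + m))
        + ∑ i ∈ Finset.range m, a i ^ 2 * laguerreNormSq α (laguerrePoly α (n + i)) := by
  have hB := isInnerProduct_laguerreInner hα
  have h1 : laguerreInner α (laguerrePoly α (n + m))
      (∑ i ∈ Finset.range m, C (a i) * laguerrePoly α (n + i)) = 0 := by
    rw [hB.sum_right]
    refine Finset.sum_eq_zero fun i hi => ?_
    have := Finset.mem_range.1 hi
    rw [hB.smul_right, laguerreInner_laguerrePoly_of_ne hα (by omega), mul_zero]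
  have h2 : laguerreInner α (∑ i ∈ Finset.range m, C (a i) * laguerrePoly α (n + i))
      (∑ i ∈ Finset.range m, C (a i) * laguerrePoly α (n + i)) =
      ∑ i ∈ Finset.range m, a i ^ 2 * laguerreNormSq α (laguerrePoly α (n + i)) := by
    rw [hB.sum_left]
    refine Finset.sum_congr rfl fun i hi => ?_
    rw [hB.sum_right, Finset.sum_eq_single i]
    · rw [hB.smul_left, hB.smul_right, laguerreNormSq]
      ring
    · intro j _ hj
      rw [hB.smul_left, hB.smul_right, laguerreInner_laguerrePoly_of_ne hα (by omega)]
      ring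
    · exact fun h => absurd hi h
  rw [laguerreWindow, hB.sub_left, hB.sub_right, hB.sub_right, h1, hB.symm (∑ i ∈ _, _) (laguerrePoly α _), h1,
    h2, laguerreNormSq]
  ring

theorem isLittleO_eval_laguerreWindow {c : ℝ} (hc : 0 < c)
    (h0 : ∑ i ∈ Finset.range m, a i = 1) :
    (fun n => (laguerreWindow α m a n).eval c) =o[atTop]
      fun n => √(laguerreNormSq α (laguerrePoly α n)) := by
  refine ((isLittleO_eval_laguerrePoly_add_sub hα hc m).sub
    (Asymptotics.IsLittleO.fun_sum (s := Finset.range m) fun i _ =>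
      (isLittleO_eval_laguerrePoly_add_sub hα hc i).const_mul_left (a i))).congr_left fun n => ?_
  simp only [mul_sub, Finset.sum_sub_distrib, ← Finset.sum_mul, h0]
  simp only [laguerreWindow, eval_sub, eval_finsetSum, eval_mul, eval_C]
  ring

theorem isLittleO_eval_derivative_laguerreWindow {c : ℝ} (hc : 0 < c)
    (h0 : ∑ i ∈ Finset.range m, a i = 1) (h1 : ∑ i ∈ Finset.range m, a i * i = m) :
    (fun n => (derivative (laguerreWindow α m a n)).eval c) =o[atTop]
      fun n => √(laguerreNormSq α (laguerrePoly α n)) := by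
  refine ((isLittleO_eval_derivative_laguerrePoly_add hα hc m).sub
    (Asymptotics.IsLittleO.fun_sum (s := Finset.range m) fun i _ =>
      (isLittleO_eval_derivative_laguerrePoly_add hα hc i).const_mul_left (a i))).congr_left
    fun n => ?_
  simp only [mul_sub, mul_add, Finset.sum_sub_distrib, Finset.sum_add_distrib, ← mul_assoc,
    ← Finset.sum_mul, h0, h1]
  simp only [laguerreWindow, derivative_sub, derivative_sum, derivative_C_mul, eval_sub,
    eval_finsetSum, eval_mul, eval_C]
  ring

theorem tendsto_sobolevNormSq_laguerreWindow (M N : ℝ) {c : ℝ} (hc : 0 < c)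
    (h0 : ∑ i ∈ Finset.range m, a i = 1) (h1 : ∑ i ∈ Finset.range m, a i * i = m) :
    Tendsto (fun n => sobolevNormSq α M N c (laguerreWindow α m a n)
      / laguerreNormSq α (laguerrePoly α (n + m))) atTop
      (𝓝 (1 + ∑ i ∈ Finset.range m, a i ^ 2)) := by
  have hpos := laguerreNormSq_laguerrePoly_pos hα
  have sq_div : ∀ {f : ℕ → ℝ}, (f =o[atTop] fun n => √(laguerreNormSq α (laguerrePoly α n))) →
      Tendsto (fun n => f n ^ 2 / laguerreNormSq α (laguerrePoly α n)) atTop (𝓝 0) := by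
    intro f hf
    have h := hf.tendsto_div_nhds_zero.pow 2
    rw [zero_pow two_ne_zero] at h
    refine h.congr fun n => ?_
    rw [div_pow, Real.sq_sqrt (hpos n).le]
  have hr := tendsto_laguerreNormSq_laguerrePoly_ratio hα
  have hs : Tendsto (fun n => ∑ i ∈ Finset.range m, a i ^ 2 *
      (laguerreNormSq α (laguerrePoly α (n + i)) / laguerreNormSq α (laguerrePoly α n))) atTop
      (𝓝 (∑ i ∈ Finset.range m, a i ^ 2 * 1)) :=
    tendsto_finsetSum _ fun i _ => (hr i).const_mul _
  have h := ((((hr m).add hs).add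
    ((sq_div (isLittleO_eval_laguerreWindow hα hc h0)).const_mul M)).add
    ((sq_div (isLittleO_eval_derivative_laguerreWindow hα hc h0 h1)).const_mul N)).div (hr m)
    one_ne_zero
  simp only [mul_one, mul_zero, add_zero, div_one] at h
  refine h.congr fun n => ?_
  have hn := (hpos n).ne'
  have hnm := (hpos (n + m)).ne'
  simp only [Pi.div_apply, mul_div_assoc']
  rw [← Finset.sum_div, ← add_div, ← add_div, ← add_div, div_div_div_cancel_right₀ hn,
    sobolevNormSq, sobolevInner, laguerreInner_laguerreWindow hα]
  ring

theorem sobolevNormSq_laguerreSobolev_le {M N : ℝ} (hM : 0 ≤ M) (hN : 0 ≤ N) (c : ℝ)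
    (m : ℕ) (a : ℕ → ℝ) (n : ℕ) :
    sobolevNormSq α M N c (laguerreSobolev α M N c (n + m))
        / laguerreNormSq α (monicLaguerre α (n + m)) ≤
      sobolevNormSq α M N c (laguerreWindow α m a n)
        / laguerreNormSq α (laguerrePoly α (n + m)) := by
  have hB := isInnerProduct_sobolevInner hα hM hN c
  have h := hB.monicOrthogonal_self_le (degree_laguerreWindow_sub_lt α m a n)
  rw [hB.smul_left, hB.smul_right] at h
  have hp := laguerreNormSq_monicLaguerre_pos hα (n + m)
  have hs : ((-1 : ℝ) ^ (n + m)) * (-1) ^ (n + m) = 1 := by rw [← mul_pow]; simp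
  rw [laguerreNormSq_laguerrePoly hα, div_div_eq_mul_div]
  refine div_le_div_of_nonneg_right (h.trans_eq ?_) hp.le
  rw [sobolevNormSq]
  linear_combination ((n + m).factorial : ℝ) ^ 2 *
    sobolevInner α M N c (laguerreWindow α m a n) (laguerreWindow α m a n) * hs

theorem laguerreNormSq_monicLaguerre_le_sobolevNormSq {M N : ℝ} (hM : 0 ≤ M) (hN : 0 ≤ N) (c : ℝ)
    (n : ℕ) :
    laguerreNormSq α (monicLaguerre α n) ≤ sobolevNormSq α M N c (laguerreSobolev α M N c n) :=
  ((isInnerProduct_laguerreInner hα).monicOrthogonal_self_le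
    (degree_monicOrthogonal_sub_lt _ n)).trans (laguerreInner_le_sobolevInner α hM hN c _)

/-- The Sobolev norms of the monic Laguerre-Sobolev polynomials are asymptotic to the norms of
the monic Laguerre polynomials. -/
theorem tendsto_sobolevNormSq_div {M N c : ℝ} (hM : 0 ≤ M) (hN : 0 ≤ N) (hc : 0 < c) :
    Tendsto (fun n => sobolevNormSq α M N c (laguerreSobolev α M N c n)
      / laguerreNormSq α (monicLaguerre α n)) atTop (𝓝 1) := by
  refine tendsto_order.2 ⟨fun b hb => Eventually.of_forall fun n => hb.trans_le ?_, fun b hb => ?_⟩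
  · rw [one_le_div (laguerreNormSq_monicLaguerre_pos hα n)]
    exact laguerreNormSq_monicLaguerre_le_sobolevNormSq hα hM hN c n
  · obtain ⟨m, a, h0, h1, h2⟩ := exists_extrapolation_weights (sub_pos.2 hb)
    have h := (tendsto_order.1 (tendsto_sobolevNormSq_laguerreWindow hα M N hc h0 h1)).2 b
      (by linarith)
    rw [← map_add_atTop_eq_nat m, eventually_map]
    filter_upwards [h] with n hn
    exact (sobolevNormSq_laguerreSobolev_le hα hM hN c m a n).trans_lt hn

theorem sobolevNormSq_laguerreSobolev {M N : ℝ} (hM : 0 ≤ M) (hN : 0 ≤ N) (c : ℝ) (n : ℕ) :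
    sobolevNormSq α M N c (laguerreSobolev α M N c n) =
      laguerreNormSq α (monicLaguerre α n)
        + M * (laguerreSobolev α M N c n).eval c * (monicLaguerre α n).eval c
        + N * (derivative (laguerreSobolev α M N c n)).eval c
          * (derivative (monicLaguerre α n)).eval c := by
  have h1 := (isInnerProduct_sobolevInner hα hM hN c).monicOrthogonal_eq_self_of_monic
    (degree_monicOrthogonal_sub_lt (laguerreInner α) n)
  have h2 := (isInnerProduct_laguerreInner hα).monicOrthogonal_eq_self_of_monic
    (degree_monicOrthogonal_sub_lt (sobolevInner α M N c) n)
  rw [(isInnerProduct_laguerreInner hα).symm] at h2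
  rw [sobolevNormSq, laguerreSobolev, ← h1, sobolevInner, h2]
  rfl

end

theorem lemma4p2 (α M N c : ℝ) (hα : -1 < α) (hM : 0 ≤ M) (hN : 0 ≤ N) (hc : 0 < c) :
    (∀ n : ℕ, 1 ≤ n →
      sobolevNormSq α M N c (laguerreSobolev α M N c n)
        = laguerreNormSq α (monicLaguerre α n)
          + coeffB1 α M N c n * laguerreNormSq α (monicLaguerre α (n - 1))) ∧
    AsympSim (fun n => sobolevNormSq α M N c (laguerreSobolev α M N c n))
      (fun n => Real.Gamma ((n : ℝ) + 1) * Real.Gamma ((n : ℝ) + α + 1)) := by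
  refine ⟨fun n _ => ?_, 1, one_ne_zero, ?_⟩
  · have hp := (laguerreNormSq_monicLaguerre_pos hα (n - 1)).ne'
    rw [sobolevNormSq_laguerreSobolev hα hM hN, coeffB1, add_mul, div_mul_cancel₀ _ hp,
      div_mul_cancel₀ _ hp, add_assoc]
  · refine (tendsto_sobolevNormSq_div hα hM hN hc).congr fun n => ?_
    rw [laguerreNormSq_monicLaguerre hα]
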